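/- Let $a<b$ and $c<d$ be real numbers. Let $\varphi_1,\dots,\varphi_n$ be an orthonormal system in the complex Hilbert space $L_2[a,b]$, let $\psi_1,\dots,\psi_m$ be an orthonormal system in the complex Hilbert space $L_2[c,d]$, and let $h_1,\dots,h_n$ and $p_1,\dots,p_m$ be essentially bounded measurable real functions on $[c,d]$ and on $[a,b]$, respectively (Lebesgue measure throughout). On the complex Hilbert space $L_2([a,b]\times[c,d])$ consider the bounded self-adjoint partial integral operators $$(T_1f)(x,y)=\int_a^b\sum_{k=1}^n\varphi_k(x)\overline{\varphi_k(s)}\,h_k(y)\,f(s,y)\,ds,\qquad (T_2f)(x,y)=\int_c^d\sum_{j=1}^m p_j(x)\,\psi_j(y)\overline{\psi_j(t)}\,f(x,t)\,dt,$$ and $T=T_1+T_2$. Let $E$ be the identity operator, and let $\sigma(A)$ and $\rho(A)=\mathbb{C}\setminus\sigma(A)$ denote the spectrum and the resolvent set of a bounded operator $A$. For a measurable real function $g$ on an interval $\Omega$, let $\mathrm{Essran}(g)$ be the set of all $\lambda\in\mathbb{R}$ such that $\{\xi\in\Omega:\ \lambda-\varepsilon<g(\xi)<\lambda+\varepsilon\}$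 has positive Lebesgue measure for every $\varepsilon>0$. For $\tau\in\mathbb{C}\setminus\{0\}$ with $\tau^{-1}\in\rho(T_1)\cap\rho(T_2)$ put $$(S_1(\tau)f)(x,y)=\sum_{k=1}^n\frac{h_k(y)}{1-\tau h_k(y)}\,\varphi_k(x)\int_a^b\overline{\varphi_k(s)}f(s,y)\,ds,\qquad W_1(\tau)=(E-\tau T_2)^{-1}S_1(\tau)T_2 .$$ The operator $W_1(\tau)$ has finite rank; let $\Delta_1(\tau)$ be the Fredholm determinant of $E-\tau^2W_1(\tau)$, where the Fredholm determinant of $E-A$ for a finite-rank operator $A$ is the determinant of the restriction of $E-A$ to the range of $A$. Let $$\mathcal{D}(T)=\{\tau\in\mathbb{C}\setminus\{0\}:\ \tau^{-1}\in\rho(T_1)\cap\rho(T_2),\ \Delta_1(\tau)=0\},\qquad \mathcal{D}_0(T)=\{1/\tau:\ \tau\in\mathcal{D}(T)\}.$$ Then $$\sigma(T_1+T_2)=\{0\}\cup\Big(\bigcup_{i=1}^n\mathrm{Essran}(h_i)\Big)\cup\Big(\bigcup_{j=1}^m\mathrm{Essran}(p_j)\Big)\cup\mathcal{D}_0(T).$$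 -/

import Mathlib

open MeasureTheory Set
open scoped ENNReal ComplexConjugate
noncomputable section
namespace PartialIntegral
variable {X Y : Type*} [MeasurableSpace X] [MeasurableSpace Y]

/-- The partial integral operator `(T f)(x, y) = ∫ k(x, s, y) f(s, y) dμ(s)` on `L²(μ × ν)`: the
bounded operator given by this formula (unique, since an element of `L²` is determined by its values
almost everywhere). When the formula does not define a bounded operator the value is `0`; this does
not happen for the degenerate kernels below, see `pio₁_spec`. -/
def pio₁ (μ : Measure X) (ν : Measure Y) (k : X → X → Y → ℂ) :
    Lp ℂ 2 (μ.prod ν) →L[ℂ] Lp ℂ 2 (μ.prod ν) :=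
  open scoped Classical in
  if hk : ∃ T : Lp ℂ 2 (μ.prod ν) →L[ℂ] Lp ℂ 2 (μ.prod ν), ∀ f : Lp ℂ 2 (μ.prod ν),
      T f =ᵐ[μ.prod ν] fun z => ∫ s, k z.1 s z.2 * f (s, z.2) ∂μ
  then hk.choose else 0

/-- The partial integral operator `(T f)(x, y) = ∫ k(x, t, y) f(x, t) dν(t)` on `L²(μ × ν)`, with
the same convention as `pio₁`, see `pio₂_spec`. -/
def pio₂ (μ : Measure X) (ν : Measure Y) (k : X → Y → Y → ℂ) :
    Lp ℂ 2 (μ.prod ν) →L[ℂ] Lp ℂ 2 (μ.prod ν) :=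
  open scoped Classical in
  if hk : ∃ T : Lp ℂ 2 (μ.prod ν) →L[ℂ] Lp ℂ 2 (μ.prod ν), ∀ f : Lp ℂ 2 (μ.prod ν),
      T f =ᵐ[μ.prod ν] fun z => ∫ t, k z.1 t z.2 * f (z.1, t) ∂ν
  then hk.choose else 0

/-- The degenerate kernel `∑ₖ φₖ(x) conj(φₖ(s)) gₖ(y)`. -/
def kernel₁ {n : ℕ} (φ : Fin n → X → ℂ) (g : Fin n → Y → ℂ) (x s : X) (y : Y) : ℂ :=
  ∑ k, φ k x * conj (φ k s) * g k y

/-- The degenerate kernel `∑ⱼ pⱼ(x) ψⱼ(y) conj(ψⱼ(t))`. -/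
def kernel₂ {m : ℕ} (ψ : Fin m → Y → ℂ) (p : Fin m → X → ℂ) (x : X) (t y : Y) : ℂ :=
  ∑ j, p j x * ψ j y * conj (ψ j t)

lemma eLpNorm_two_sq {Z : Type*} [MeasurableSpace Z] (ρ : Measure Z) (f : Z → ℂ) :
    eLpNorm f 2 ρ = (∫⁻ z, ‖f z‖ₑ ^ (2 : ℝ) ∂ρ) ^ (1 / 2 : ℝ) := by
  rw [eLpNorm_eq_lintegral_rpow_enorm_toReal (by norm_num) (by norm_num)]; simp

variable {μ : Measure X} {ν : Measure Y} [SFinite μ] [SFinite ν]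

/-- slices of a square integrable function are square integrable -/
lemma ae_slice {f : X × Y → ℂ} (hf : MemLp f 2 (μ.prod ν)) :
    ∀ᵐ y ∂ν, MemLp (fun s => f (s, y)) 2 μ := by
  have h1 : MemLp (fun w : Y × X => f w.swap) 2 (ν.prod μ) :=
    hf.comp_measurePreserving Measure.measurePreserving_swap
  have h2 := h1.1.prodMk_left
  have h3 : ∫⁻ y, ∫⁻ s, ‖f (s, y)‖ₑ ^ (2 : ℝ) ∂μ ∂ν ≠ ∞ := by
    have h4 := h1.2
    rw [eLpNorm_two_sq, ENNReal.rpow_lt_top_iff_of_pos (by norm_num),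
      lintegral_prod _ (h1.1.enorm.pow_const _)] at h4
    exact h4.ne
  have h5 := ae_lt_top' (h1.1.enorm.pow_const (2 : ℝ)).lintegral_prod_right' h3
  filter_upwards [h2, h5] with y hy hy'
  refine ⟨hy, ?_⟩
  rw [eLpNorm_two_sq, ENNReal.rpow_lt_top_iff_of_pos (by norm_num)]
  exact hy'

lemma ae_slice_integrable {v : X → ℂ} (hv : MemLp v 2 μ) {f : X × Y → ℂ}
    (hf : MemLp f 2 (μ.prod ν)) :
    ∀ᵐ y ∂ν, Integrable (fun s => conj (v s) * f (s, y)) μ := by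
  filter_upwards [ae_slice hf] with y hy
  exact MemLp.integrable_mul (p := 2) (q := 2) hv.star hy

lemma memLp_slice {v : X → ℂ} (hv : MemLp v 2 μ) {f : X × Y → ℂ}
    (hf : MemLp f 2 (μ.prod ν)) :
    AEStronglyMeasurable (fun y => ∫ s, conj (v s) * f (s, y) ∂μ) ν ∧
    eLpNorm (fun y => ∫ s, conj (v s) * f (s, y) ∂μ) 2 ν
      ≤ eLpNorm v 2 μ * eLpNorm f 2 (μ.prod ν) := by
  have hs : MemLp (fun w : Y × X => f w.swap) 2 (ν.prod μ) :=
    hf.comp_measurePreserving Measure.measurePreserving_swap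
  have hm : AEStronglyMeasurable (fun w : Y × X => conj (v w.2) * f (w.2, w.1)) (ν.prod μ) :=
    (hv.star.1.comp_snd).mul hs.1
  refine ⟨hm.integral_prod_right', ?_⟩
  have hb : ∀ᵐ y ∂ν, ‖∫ s, conj (v s) * f (s, y) ∂μ‖ₑ ^ (2 : ℝ) ≤
      eLpNorm v 2 μ ^ (2 : ℝ) * ∫⁻ s, ‖f (s, y)‖ₑ ^ (2 : ℝ) ∂μ := by
    filter_upwards [ae_slice hf] with y hy
    have h1 : ‖∫ s, conj (v s) * f (s, y) ∂μ‖ₑ ≤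
        (∫⁻ s, ‖v s‖ₑ ^ (2 : ℝ) ∂μ) ^ (1 / 2 : ℝ) *
          (∫⁻ s, ‖f (s, y)‖ₑ ^ (2 : ℝ) ∂μ) ^ (1 / 2 : ℝ) := by
      refine (enorm_integral_le_lintegral_enorm _).trans ?_
      have := ENNReal.lintegral_mul_le_Lp_mul_Lq μ Real.HolderConjugate.two_two
        hv.1.enorm hy.1.enorm
      simpa [enorm_mul] using this
    calc _ ≤ _ := ENNReal.rpow_le_rpow h1 (by norm_num : (0 : ℝ) ≤ 2)
      _ = _ := by
        rw [eLpNorm_two_sq, ENNReal.mul_rpow_of_nonneg _ _ (by norm_num), ← ENNReal.rpow_mul,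
          ← ENNReal.rpow_mul]
        norm_num
  have hi : ∫⁻ y, ‖∫ s, conj (v s) * f (s, y) ∂μ‖ₑ ^ (2 : ℝ) ∂ν ≤
      eLpNorm v 2 μ ^ (2 : ℝ) * eLpNorm f 2 (μ.prod ν) ^ (2 : ℝ) := by
    refine (lintegral_mono_ae hb).trans ?_
    have hms : AEMeasurable (fun y => ∫⁻ s, ‖f (s, y)‖ₑ ^ (2 : ℝ) ∂μ) ν :=
      (hs.1.enorm.pow_const (2 : ℝ)).lintegral_prod_right'
    rw [lintegral_const_mul'' _ hms]
    gcongr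
    rw [eLpNorm_two_sq _ f, ← ENNReal.rpow_mul, lintegral_prod_symm _ (hf.1.enorm.pow_const _)]
    norm_num
  rw [eLpNorm_two_sq]
  calc _ ≤ _ := ENNReal.rpow_le_rpow hi (by norm_num : (0 : ℝ) ≤ 1 / 2)
    _ = _ := by
      rw [ENNReal.mul_rpow_of_nonneg _ _ (by norm_num), ← ENNReal.rpow_mul, ← ENNReal.rpow_mul]
      norm_num

lemma tensor_norm {u : X → ℂ} (hu : MemLp u 2 μ) {w : Y → ℂ} (hw : AEStronglyMeasurable w ν) :
    AEStronglyMeasurable (fun z : X × Y => u z.1 * w z.2) (μ.prod ν) ∧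
    eLpNorm (fun z : X × Y => u z.1 * w z.2) 2 (μ.prod ν) = eLpNorm u 2 μ * eLpNorm w 2 ν := by
  refine ⟨hu.1.comp_fst.mul hw.comp_snd, ?_⟩
  rw [eLpNorm_two_sq, eLpNorm_two_sq, eLpNorm_two_sq, ← ENNReal.mul_rpow_of_nonneg _ _ (by norm_num),
    ← lintegral_prod_mul (hu.1.enorm.pow_const _) (hw.enorm.pow_const _)]
  congr 1
  refine lintegral_congr fun z => ?_
  rw [enorm_mul, ENNReal.mul_rpow_of_nonneg _ _ (by norm_num)]

lemma exists_single {u v : X → ℂ} {g : Y → ℂ} (hu : MemLp u 2 μ) (hv : MemLp v 2 μ)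
    (hg : MemLp g ∞ ν) :
    ∃ T : Lp ℂ 2 (μ.prod ν) →L[ℂ] Lp ℂ 2 (μ.prod ν), ∀ f : Lp ℂ 2 (μ.prod ν),
      T f =ᵐ[μ.prod ν] fun z => u z.1 * (g z.2 * ∫ s, conj (v s) * f (s, z.2) ∂μ) := by
  have key : ∀ f : Lp ℂ 2 (μ.prod ν),
      AEStronglyMeasurable (fun z : X × Y => u z.1 * (g z.2 * ∫ s, conj (v s) * f (s, z.2) ∂μ))
        (μ.prod ν) ∧
      eLpNorm (fun z : X × Y => u z.1 * (g z.2 * ∫ s, conj (v s) * f (s, z.2) ∂μ)) 2 (μ.prod ν) ≤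
        eLpNorm u 2 μ * (eLpNorm g ∞ ν * eLpNorm v 2 μ) * eLpNorm f 2 (μ.prod ν) := by
    intro f
    obtain ⟨h1, h2⟩ := memLp_slice hv (Lp.memLp f)
    obtain ⟨h3, h4⟩ := tensor_norm (μ := μ) hu (hg.1.mul h1)
    refine ⟨h3, ?_⟩
    refine h4.le.trans ?_
    rw [mul_assoc]
    gcongr
    refine (eLpNorm_smul_le_eLpNorm_top_mul_eLpNorm (𝕜 := ℂ) 2 h1 g).trans ?_
    rw [mul_assoc]
    gcongr
  have hC : eLpNorm u 2 μ * (eLpNorm g ∞ ν * eLpNorm v 2 μ) ≠ ∞ :=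
    ENNReal.mul_ne_top hu.2.ne (ENNReal.mul_ne_top hg.2.ne hv.2.ne)
  have hmem : ∀ f : Lp ℂ 2 (μ.prod ν),
      MemLp (fun z : X × Y => u z.1 * (g z.2 * ∫ s, conj (v s) * f (s, z.2) ∂μ)) 2 (μ.prod ν) :=
    fun f => ⟨(key f).1, (key f).2.trans_lt (ENNReal.mul_lt_top hC.lt_top (Lp.memLp f).2)⟩
  have slice : ∀ {F G : X × Y → ℂ}, F =ᵐ[μ.prod ν] G →
      ∀ᵐ z ∂(μ.prod ν), ∀ᵐ s ∂μ, F (s, z.2) = G (s, z.2) := by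
    intro F G hFG
    have h1 : ∀ᵐ w ∂(ν.prod μ), F w.swap = G w.swap :=
      Measure.measurePreserving_swap.quasiMeasurePreserving.ae hFG
    exact Measure.quasiMeasurePreserving_snd.ae (Measure.ae_ae_of_ae_prod h1)
  let L : Lp ℂ 2 (μ.prod ν) →ₗ[ℂ] Lp ℂ 2 (μ.prod ν) :=
    { toFun := fun f => (hmem f).toLp _
      map_add' := by
        intro f f'
        rw [← MemLp.toLp_add]
        refine MemLp.toLp_congr _ _ ?_
        filter_upwards [slice (Lp.coeFn_add f f'),
          Measure.quasiMeasurePreserving_snd.ae (ae_slice_integrable hv (Lp.memLp f)),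
          Measure.quasiMeasurePreserving_snd.ae (ae_slice_integrable hv (Lp.memLp f'))]
          with z hz h1 h2
        have : ∫ s, conj (v s) * (f + f') (s, z.2) ∂μ =
            ∫ s, (conj (v s) * f (s, z.2) + conj (v s) * f' (s, z.2)) ∂μ := by
          refine integral_congr_ae ?_
          filter_upwards [hz] with s hs
          simp only [hs, Pi.add_apply, mul_add]
        simp only [this, integral_add h1 h2, Pi.add_apply]
        ring
      map_smul' := by
        intro c f
        rw [RingHom.id_apply, ← MemLp.toLp_const_smul]
        refine MemLp.toLp_congr _ _ ?_
        filter_upwards [slice (Lp.coeFn_smul c f)] with z hz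
        have : ∫ s, conj (v s) * (c • f) (s, z.2) ∂μ =
            ∫ s, c * (conj (v s) * f (s, z.2)) ∂μ := by
          refine integral_congr_ae ?_
          filter_upwards [hz] with s hs
          simp only [hs, Pi.smul_apply, smul_eq_mul]
          ring
        simp only [this, integral_const_mul, Pi.smul_apply, smul_eq_mul]
        ring }
  refine ⟨L.mkContinuous (eLpNorm u 2 μ * (eLpNorm g ∞ ν * eLpNorm v 2 μ)).toReal ?_,
    fun f => (hmem f).coeFn_toLp⟩
  intro f
  change ‖(hmem f).toLp _‖ ≤ _
  rw [Lp.norm_toLp, Lp.norm_def, ← ENNReal.toReal_mul]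
  exact ENNReal.toReal_mono (ENNReal.mul_ne_top hC (Lp.memLp f).2.ne) (key f).2

lemma exists_pio₁_sum {n : ℕ} {φ : Fin n → X → ℂ} {g : Fin n → Y → ℂ}
    (hφ : ∀ k, MemLp (φ k) 2 μ) (hg : ∀ k, MemLp (g k) ∞ ν) :
    ∃ T : Fin n → Lp ℂ 2 (μ.prod ν) →L[ℂ] Lp ℂ 2 (μ.prod ν),
      (∀ k f, T k f =ᵐ[μ.prod ν]
        fun z => φ k z.1 * (g k z.2 * ∫ s, conj (φ k s) * f (s, z.2) ∂μ)) ∧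
      ∀ f, (∑ k, T k) f =ᵐ[μ.prod ν]
        fun z => ∫ s, kernel₁ φ g z.1 s z.2 * f (s, z.2) ∂μ := by
  choose T hT using fun k => exists_single (hφ k) (hφ k) (hg k)
  refine ⟨T, hT, fun f => ?_⟩
  rw [sum_apply]
  filter_upwards [Lp.coeFn_fun_finsetSum Finset.univ (fun k => T k f),
    ae_all_iff.2 fun k => hT k f,
    ae_all_iff.2 fun k => Measure.quasiMeasurePreserving_snd.ae
      (ae_slice_integrable (hφ k) (Lp.memLp f))] with z h1 h2 h3
  rw [h1]
  simp only [h2, kernel₁, Finset.sum_mul]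
  rw [integral_finsetSum]
  · refine Finset.sum_congr rfl fun k _ => ?_
    rw [← integral_const_mul, ← integral_const_mul]
    congr 1; ext s; ring
  · intro k _
    refine ((h3 k).const_mul (φ k z.1 * g k z.2)).congr (.of_forall fun s => ?_)
    simp only; ring

lemma exists_pio₂_sum {m : ℕ} {ψ : Fin m → Y → ℂ} {p : Fin m → X → ℂ}
    (hψ : ∀ j, MemLp (ψ j) 2 ν) (hp : ∀ j, MemLp (p j) ∞ μ) :
    ∃ T : Fin m → Lp ℂ 2 (μ.prod ν) →L[ℂ] Lp ℂ 2 (μ.prod ν),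
      (∀ j f, T j f =ᵐ[μ.prod ν]
        fun z => ψ j z.2 * (p j z.1 * ∫ t, conj (ψ j t) * f (z.1, t) ∂ν)) ∧
      ∀ f, (∑ j, T j) f =ᵐ[μ.prod ν]
        fun z => ∫ t, kernel₂ ψ p z.1 t z.2 * f (z.1, t) ∂ν := by
  obtain ⟨T, hT, hS⟩ := exists_pio₁_sum (μ := ν) (ν := μ) hψ hp
  have sw : MeasurePreserving Prod.swap (μ.prod ν) (ν.prod μ) := Measure.measurePreserving_swap
  have sw' : MeasurePreserving Prod.swap (ν.prod μ) (μ.prod ν) := Measure.measurePreserving_swap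
  let U : Lp ℂ 2 (ν.prod μ) →L[ℂ] Lp ℂ 2 (μ.prod ν) :=
    (Lp.compMeasurePreservingₗᵢ ℂ Prod.swap sw).toContinuousLinearMap
  let V : Lp ℂ 2 (μ.prod ν) →L[ℂ] Lp ℂ 2 (ν.prod μ) :=
    (Lp.compMeasurePreservingₗᵢ ℂ Prod.swap sw').toContinuousLinearMap
  have hU : ∀ f, U f =ᵐ[μ.prod ν] fun z => f z.swap :=
    fun f => Lp.coeFn_compMeasurePreserving f sw
  have hV : ∀ f, ∀ᵐ z ∂(μ.prod ν), ∀ᵐ t ∂ν, V f (t, z.1) = f (z.1, t) := by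
    intro f
    have h1 : ∀ᵐ w ∂(ν.prod μ), V f w = f w.swap := Lp.coeFn_compMeasurePreserving f sw'
    exact Measure.quasiMeasurePreserving_fst.ae
      (Measure.ae_ae_of_ae_prod (sw.quasiMeasurePreserving.ae h1))
  refine ⟨fun j => U ∘L T j ∘L V, fun j f => ?_, fun f => ?_⟩
  · filter_upwards [hU (T j (V f)), sw.quasiMeasurePreserving.ae (hT j (V f)), hV f] with z h1 h2 h3
    change U (T j (V f)) z = _
    rw [h1, h2]
    simp only [Prod.fst_swap, Prod.snd_swap]
    congr 2
    refine integral_congr_ae ?_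
    filter_upwards [h3] with t ht
    rw [ht]
  · have h0 : (∑ j, U ∘L T j ∘L V) f = U ((∑ j, T j) (V f)) := by
      simp [sum_apply]
    rw [h0]
    filter_upwards [hU ((∑ j, T j) (V f)), sw.quasiMeasurePreserving.ae (hS (V f)), hV f]
      with z h1 h2 h3
    rw [h1, h2]
    refine integral_congr_ae ?_
    filter_upwards [h3] with t ht
    simp only [Prod.fst_swap, Prod.snd_swap, ht, kernel₁, kernel₂]
    congr 1
    refine Finset.sum_congr rfl fun j _ => ?_
    ring

/-- A degenerate kernel with essentially bounded symbols does define a bounded operator. -/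
theorem pio₁_spec {n : ℕ} {φ : Fin n → X → ℂ} {g : Fin n → Y → ℂ} (hφ : ∀ k, MemLp (φ k) 2 μ)
    (hg : ∀ k, MemLp (g k) ∞ ν) (f : Lp ℂ 2 (μ.prod ν)) :
    pio₁ μ ν (kernel₁ φ g) f =ᵐ[μ.prod ν]
      fun z => ∫ s, kernel₁ φ g z.1 s z.2 * f (s, z.2) ∂μ := by
  obtain ⟨T, -, hT⟩ := exists_pio₁_sum hφ hg
  have h : ∃ T : Lp ℂ 2 (μ.prod ν) →L[ℂ] Lp ℂ 2 (μ.prod ν), ∀ f : Lp ℂ 2 (μ.prod ν),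
      T f =ᵐ[μ.prod ν] fun z => ∫ s, kernel₁ φ g z.1 s z.2 * f (s, z.2) ∂μ := ⟨_, hT⟩
  unfold pio₁
  rw [dif_pos h]
  exact h.choose_spec f

theorem pio₂_spec {m : ℕ} {ψ : Fin m → Y → ℂ} {p : Fin m → X → ℂ} (hψ : ∀ j, MemLp (ψ j) 2 ν)
    (hp : ∀ j, MemLp (p j) ∞ μ) (f : Lp ℂ 2 (μ.prod ν)) :
    pio₂ μ ν (kernel₂ ψ p) f =ᵐ[μ.prod ν]
      fun z => ∫ t, kernel₂ ψ p z.1 t z.2 * f (z.1, t) ∂ν := by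
  obtain ⟨T, -, hT⟩ := exists_pio₂_sum hψ hp
  have h : ∃ T : Lp ℂ 2 (μ.prod ν) →L[ℂ] Lp ℂ 2 (μ.prod ν), ∀ f : Lp ℂ 2 (μ.prod ν),
      T f =ᵐ[μ.prod ν] fun z => ∫ t, kernel₂ ψ p z.1 t z.2 * f (z.1, t) ∂ν := ⟨_, hT⟩
  unfold pio₂
  rw [dif_pos h]
  exact h.choose_spec f

/-- The product of the two kinds of operators has finite rank. -/
theorem finiteDimensional_range_pio₁_comp_pio₂ {n m : ℕ} {φ : Fin n → X → ℂ} {g : Fin n → Y → ℂ}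
    {ψ : Fin m → Y → ℂ} {p : Fin m → X → ℂ}
    (hφ : ∀ k, MemLp (φ k) 2 μ) (hg : ∀ k, MemLp (g k) ∞ ν)
    (hψ : ∀ j, MemLp (ψ j) 2 ν) (hp : ∀ j, MemLp (p j) ∞ μ) :
    FiniteDimensional ℂ
      (LinearMap.range (pio₁ μ ν (kernel₁ φ g) ∘L pio₂ μ ν (kernel₂ ψ p)).toLinearMap) := by
  obtain ⟨A, hA, hA'⟩ := exists_pio₁_sum (ν := ν) hφ hg
  obtain ⟨B, hB, hB'⟩ := exists_pio₂_sum (μ := μ) hψ hp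
  have eA : pio₁ μ ν (kernel₁ φ g) = ∑ k, A k := by
    ext1 f
    exact Lp.ext ((pio₁_spec hφ hg f).trans (hA' f).symm)
  have eB : pio₂ μ ν (kernel₂ ψ p) = ∑ j, B j := by
    ext1 f
    exact Lp.ext ((pio₂_spec hψ hp f).trans (hB' f).symm)
  have hmem : ∀ i : Fin n × Fin m,
      MemLp (fun z : X × Y => φ i.1 z.1 * (g i.1 z.2 * ψ i.2 z.2)) 2 (μ.prod ν) := by
    intro i
    have hw : MemLp (fun y => g i.1 y * ψ i.2 y) 2 ν := (hψ i.2).mul (hg i.1)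
    obtain ⟨h1, h2⟩ := tensor_norm (μ := μ) (hφ i.1) hw.1
    exact ⟨h1, h2.trans_lt (ENNReal.mul_lt_top (hφ i.1).2 hw.2)⟩
  let e : Fin n × Fin m → Lp ℂ 2 (μ.prod ν) := fun i => (hmem i).toLp _
  have hAB : ∀ k j f, A k (B j f) ∈ Submodule.span ℂ (Set.range e) := by
    intro k j f
    have : A k (B j f) =
        (∫ s, conj (φ k s) * (p j s * ∫ t, conj (ψ j t) * f (s, t) ∂ν) ∂μ) • e (k, j) := by
      refine Lp.ext ?_
      have sl : ∀ᵐ z ∂(μ.prod ν), ∀ᵐ s ∂μ, B j f (s, z.2) =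
          ψ j z.2 * (p j s * ∫ t, conj (ψ j t) * f (s, t) ∂ν) := by
        have h1 := (Measure.measurePreserving_swap (μ := ν) (ν := μ)).quasiMeasurePreserving.ae
          (hB j f)
        exact Measure.quasiMeasurePreserving_snd.ae (Measure.ae_ae_of_ae_prod h1)
      filter_upwards [hA k (B j f), sl, (hmem (k, j)).coeFn_toLp, Lp.coeFn_smul
        (∫ s, conj (φ k s) * (p j s * ∫ t, conj (ψ j t) * f (s, t) ∂ν) ∂μ) (e (k, j))]
        with z h1 h2 h3 h4
      rw [h1, h4, Pi.smul_apply, h3, smul_eq_mul]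
      have : ∫ s, conj (φ k s) * B j f (s, z.2) ∂μ =
          ∫ s, conj (φ k s) * (p j s * ∫ t, conj (ψ j t) * f (s, t) ∂ν) * ψ j z.2 ∂μ := by
        refine integral_congr_ae ?_
        filter_upwards [h2] with s hs
        rw [hs]; ring
      rw [this, integral_mul_const]
      ring
    rw [this]
    exact Submodule.smul_mem _ _ (Submodule.subset_span ⟨_, rfl⟩)
  have : FiniteDimensional ℂ (Submodule.span ℂ (Set.range e)) :=
    FiniteDimensional.span_of_finite ℂ (Set.finite_range e)
  refine Submodule.finiteDimensional_of_le (S₂ := Submodule.span ℂ (Set.range e)) ?_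
  rintro _ ⟨f, rfl⟩
  simp only [eA, eB, ContinuousLinearMap.coe_coe, ContinuousLinearMap.comp_apply, sum_apply, map_sum]
  exact Submodule.sum_mem _ fun k _ => Submodule.sum_mem _ fun j _ => hAB _ _ _

/-- The Fredholm determinant `det(E - A)` of an operator `A` of finite rank: the determinant of the
restriction of `E - A` to the finite-dimensional invariant subspace `range A`. -/
def fredholmDet {V : Type*} [AddCommGroup V] [Module ℂ V] (A : V →ₗ[ℂ] V) : ℂ :=
  LinearMap.det ((LinearMap.id - A).restrict
    (p := LinearMap.range A) (q := LinearMap.range A)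
    fun v hv => Submodule.sub_mem _ hv (LinearMap.mem_range_self A v))

/-- Lebesgue measure on `[a, b]`. -/
abbrev leb (a b : ℝ) : Measure ℝ := volume.restrict (Icc a b)

/-- The essential values of a real function `f` on `Ω ⊆ ℝ`. -/
def Essran (Ω : Set ℝ) (f : ℝ → ℝ) : Set ℝ :=
  {l | ∀ ε > 0, 0 < volume {ξ | ξ ∈ Ω ∧ l - ε < f ξ ∧ f ξ < l + ε}}

/-- The complex Hilbert space `L₂([a, b] × [c, d])`. -/
abbrev L2Rect (a b c d : ℝ) : Type := Lp ℂ 2 ((leb a b).prod (leb c d))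

section operators

variable {a b c d : ℝ} {n m : ℕ}
  (φ : Fin n → Lp ℂ 2 (leb a b)) (h : Fin n → ℝ → ℝ)
  (ψ : Fin m → Lp ℂ 2 (leb c d)) (p : Fin m → ℝ → ℝ)

/-- `(T₁ f)(x, y) = ∫ₐᵇ (∑ₖ φₖ(x) conj(φₖ(s)) hₖ(y)) f(s, y) ds` on `L₂([a, b] × [c, d])`. -/
def T₁ (c d : ℝ) : L2Rect a b c d →L[ℂ] L2Rect a b c d :=
  pio₁ (leb a b) (leb c d) (kernel₁ (fun k => ⇑(φ k)) fun k y => (h k y : ℂ))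

/-- `(T₂ f)(x, y) = ∫_c^d (∑ⱼ pⱼ(x) ψⱼ(y) conj(ψⱼ(t))) f(x, t) dt` on `L₂([a, b] × [c, d])`. -/
def T₂ (a b : ℝ) : L2Rect a b c d →L[ℂ] L2Rect a b c d :=
  pio₂ (leb a b) (leb c d) (kernel₂ (fun j => ⇑(ψ j)) fun j x => (p j x : ℂ))

/-- `S₁(τ) = ∑ₖ (hₖ(y) / (1 - τ hₖ(y))) Pₖ`, with `(Pₖ f)(x, y) = φₖ(x) ∫ conj(φₖ(s)) f(s, y) ds`. -/
def S₁ (c d : ℝ) (τ : ℂ) : L2Rect a b c d →L[ℂ] L2Rect a b c d :=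
  pio₁ (leb a b) (leb c d)
    (kernel₁ (fun k => ⇑(φ k)) fun k y => (h k y : ℂ) / (1 - τ * (h k y : ℂ)))

/-- `W₁(τ) = (E - τ T₂)⁻¹ S₁(τ) T₂`, an operator of finite rank
(compare `finiteDimensional_range_pio₁_comp_pio₂`). -/
def W₁ (τ : ℂ) : L2Rect a b c d →L[ℂ] L2Rect a b c d :=
  Ring.inverse (1 - τ • T₂ ψ p a b) * S₁ φ h c d τ * T₂ ψ p a b

/-- `Δ₁(τ)`, the Fredholm determinant of `E - τ² W₁(τ)`. -/
def Δ₁ (τ : ℂ) : ℂ := fredholmDet (τ ^ 2 • W₁ φ h ψ p τ).toLinearMap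

/-- The set `𝒟(T)` of all `τ ≠ 0` with `τ⁻¹ ∈ ρ(T₁) ∩ ρ(T₂)` and `Δ₁(τ) = 0`. -/
def setD : Set ℂ :=
  {τ | τ ≠ 0 ∧ τ⁻¹ ∈ resolventSet ℂ (T₁ φ h c d) ∩ resolventSet ℂ (T₂ ψ p a b) ∧
    Δ₁ φ h ψ p τ = 0}

/-- The set `𝒟₀(T) = {1 / τ : τ ∈ 𝒟(T)}`. -/
def setD₀ : Set ℂ := {ξ | ∃ τ ∈ setD φ h ψ p, ξ = 1 / τ}

end operators

end PartialIntegral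

end

/-!
Put `T = T₁ + T₂`. If `w` is orthogonal to all `ψⱼ`, then `T₂ (φᵢ ⊗ w) = 0` and
`T₁ (φᵢ ⊗ w) = φᵢ ⊗ (hᵢ w)`. As Lebesgue measure has no atoms, such a `w ≠ 0` can be found with
support in any given set of positive measure; choosing the set where `hᵢ` is close to `l` produces
approximate eigenvectors for each `l` in the essential range of `hᵢ`. Exchanging the variables gives
the essential ranges of the `pⱼ`, and `u ⊗ w` with `u ⟂ φᵢ` and `w ⟂ ψⱼ` gives the spectral value
`0`.

For every other `l = 1 / τ`, orthonormality of the `φₖ` shows that `S₁(τ) = (1 - τ T₁)⁻¹ T₁`, so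
`1 - τ T = (1 - τ T₁) (1 - τ T₂) (1 - τ² W₁(τ))` with invertible first two factors. Since `W₁(τ)`
has finite rank, the last factor is invertible exactly when its Fredholm determinant is nonzero.
-/

namespace PartialIntegral

section Factorization

lemma bijective_id_sub_restrict_range_iff {R V : Type*} [Ring R] [AddCommGroup V] [Module R V]
    (A : V →ₗ[R] V) :
    Function.Bijective ((LinearMap.id - A).restrict
        (p := LinearMap.range A) (q := LinearMap.range A)
        fun v hv => Submodule.sub_mem _ hv (LinearMap.mem_range_self A v)) ↔
      Function.Bijective (LinearMap.id - A : V →ₗ[R] V) := by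
  refine and_congr ?_ ?_
  · rw [injective_iff_map_eq_zero, injective_iff_map_eq_zero]
    refine ⟨fun h v hv => ?_, fun h v hv => Subtype.ext (h v (congrArg Subtype.val hv))⟩
    have hAv : A v = v := (sub_eq_zero.1 hv).symm
    exact congrArg Subtype.val (h ⟨v, v, hAv⟩ (Subtype.ext hv))
  · refine ⟨fun h v => ?_, fun h ⟨w, hw⟩ => ?_⟩
    · obtain ⟨w, hw⟩ := h ⟨A v, v, rfl⟩
      have hw' : (w : V) - A w = A v := congrArg Subtype.val hw
      refine ⟨v + w, ?_⟩
      simp only [LinearMap.sub_apply, LinearMap.id_apply, map_add, ← hw']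
      abel
    · obtain ⟨v, hv⟩ := h w
      have hv' : w + A v = v := by rw [← hv]; simp
      exact ⟨⟨v, hv' ▸ Submodule.add_mem _ hw (LinearMap.mem_range_self A v)⟩, Subtype.ext hv⟩

lemma fredholmDet_ne_zero_iff {V : Type*} [AddCommGroup V] [Module ℂ V] (A : V →ₗ[ℂ] V)
    [FiniteDimensional ℂ (LinearMap.range A)] :
    fredholmDet A ≠ 0 ↔ Function.Bijective (LinearMap.id - A : V →ₗ[ℂ] V) := by
  rw [← bijective_id_sub_restrict_range_iff, ← Module.End.isUnit_iff,
    LinearMap.isUnit_iff_isUnit_det, isUnit_iff_ne_zero, fredholmDet]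

variable {𝕜 R : Type*} [Field 𝕜] [Ring R] [Algebra 𝕜 R] {a b s : R} {l τ : 𝕜}

lemma isUnit_one_sub_inv_smul_iff (hl : l ≠ 0) :
    IsUnit (1 - l⁻¹ • a) ↔ l ∈ resolventSet 𝕜 a := by
  have h : algebraMap 𝕜 R l - a = l • (1 - l⁻¹ • a) := by
    rw [smul_sub, smul_inv_smul₀ hl, Algebra.algebraMap_eq_smul_one]
  rw [spectrum.mem_resolventSet_iff, h]
  exact (isUnit_smul_iff (Units.mk0 l hl) (1 - l⁻¹ • a)).symm

lemma one_sub_smul_mul_eq_of_eq_add (hs : s = a + τ • (a * s)) : (1 - τ • a) * s = a := by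
  rw [sub_mul, one_mul, smul_mul_assoc, sub_eq_iff_eq_add]
  exact hs

lemma isUnit_one_sub_smul_of_eq_add (hc : Commute a s) (hs : s = a + τ • (a * s)) :
    IsUnit (1 - τ • a) := by
  have h_inv : (1 - τ • a) * (1 + τ • s) = 1 := by
    rw [mul_add, mul_one, mul_smul_comm, one_sub_smul_mul_eq_of_eq_add hs, sub_add_cancel]
  have h_comm : Commute (1 - τ • a) (1 + τ • s) :=
    (Commute.one_right _).add_right
      ((Commute.one_left _).sub_left ((hc.smul_left τ).smul_right τ))
  exact isUnit_iff_exists.2 ⟨1 + τ • s, h_inv, h_comm.eq ▸ h_inv⟩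

lemma one_sub_smul_add_eq_mul (hs : (1 - τ • a) * s = a) (hb : IsUnit (1 - τ • b)) :
    1 - τ • (a + b) =
      (1 - τ • a) * (1 - τ • b) * (1 - τ ^ 2 • (Ring.inverse (1 - τ • b) * s * b)) := by
  have h_cancel : (1 - τ • b) * (Ring.inverse (1 - τ • b) * s * b) = s * b := by
    rw [← mul_assoc, ← mul_assoc, Ring.mul_inverse_cancel _ hb, one_mul]
  rw [mul_sub, mul_one, mul_smul_comm, mul_assoc (1 - τ • a), h_cancel, ← mul_assoc, hs]
  simp only [sub_mul, mul_sub, one_mul, mul_one, smul_mul_smul_comm, smul_add, pow_two]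
  abel

lemma mem_spectrum_add_iff {V : Type*} [NormedAddCommGroup V] [NormedSpace ℂ V] [CompleteSpace V]
    {A B S : V →L[ℂ] V} {l : ℂ} (hl : l ≠ 0) (hA : l ∈ resolventSet ℂ A)
    (hB : l ∈ resolventSet ℂ B) (hS : (1 - l⁻¹ • A) * S = A)
    [FiniteDimensional ℂ (LinearMap.range (S * B).toLinearMap)] :
    l ∈ spectrum ℂ (A + B) ↔
      fredholmDet (l⁻¹ ^ 2 • (Ring.inverse (1 - l⁻¹ • B) * S * B)).toLinearMap = 0 := by
  set W : V →L[ℂ] V := l⁻¹ ^ 2 • (Ring.inverse (1 - l⁻¹ • B) * S * B) with hW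
  have hW_range : FiniteDimensional ℂ (LinearMap.range W.toLinearMap) := by
    have hW_comp : W.toLinearMap =
        (l⁻¹ ^ 2 • Ring.inverse (1 - l⁻¹ • B)).toLinearMap ∘ₗ (S * B).toLinearMap := by
      ext1 v
      simp [hW]
    rw [hW_comp, LinearMap.range_comp]
    infer_instance
  have h_det : fredholmDet W.toLinearMap ≠ 0 ↔ IsUnit (1 - W) := by
    rw [fredholmDet_ne_zero_iff, ContinuousLinearMap.isUnit_iff_bijective]
    rfl
  have h_fact : IsUnit (1 - l⁻¹ • (A + B)) ↔ IsUnit (1 - W) := by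
    have hA' := (isUnit_one_sub_inv_smul_iff hl).2 hA
    have hB' := (isUnit_one_sub_inv_smul_iff hl).2 hB
    rw [one_sub_smul_add_eq_mul hS hB']
    exact (hA'.mul hB').mul_left_iff
  rw [← not_iff_not, ← ne_eq, h_det, ← h_fact, isUnit_one_sub_inv_smul_iff hl,
    spectrum, notMem_compl_iff]

lemma mem_spectrum_of_approx {𝕜 V : Type*} [NontriviallyNormedField 𝕜] [NormedAddCommGroup V]
    [NormedSpace 𝕜 V] {A : V →L[𝕜] V} {l : 𝕜}
    (hA : ∀ ε > 0, ∃ v, v ≠ 0 ∧ ‖A v - l • v‖ ≤ ε * ‖v‖) : l ∈ spectrum 𝕜 A := by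
  rintro ⟨u, hu⟩
  set R : V →L[𝕜] V := ↑u⁻¹ with hR
  have hR_left_inv : ∀ v, R (l • v - A v) = v := fun v => by
    have h : (R * u) v = v := by simp [hR]
    rw [hu] at h
    simpa [Algebra.algebraMap_eq_smul_one] using h
  obtain ⟨v, hv, hv_le⟩ := hA (1 / (‖R‖ + 1)) (by positivity)
  have hv_pos : 0 < ‖v‖ := norm_pos_iff.2 hv
  have h_lt : ‖R‖ * (1 / (‖R‖ + 1)) < 1 := by
    rw [mul_one_div, div_lt_one (by positivity)]
    exact lt_add_one _
  refine lt_irrefl ‖v‖ ?_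
  calc ‖v‖ = ‖R (l • v - A v)‖ := by rw [hR_left_inv]
    _ ≤ ‖R‖ * ‖A v - l • v‖ := by rw [norm_sub_rev (A v)]; exact R.le_opNorm _
    _ ≤ ‖R‖ * (1 / (‖R‖ + 1) * ‖v‖) := by gcongr
    _ = ‖R‖ * (1 / (‖R‖ + 1)) * ‖v‖ := (mul_assoc _ _ _).symm
    _ < ‖v‖ := mul_lt_of_lt_one_left hv_pos h_lt

end Factorization

section EssentialRange

variable {X : Type*} [MeasurableSpace X] {μ : Measure X}

/-- The essential range of `g`: the values whose neighbourhoods are hit by `g` on a set of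
positive measure. -/
def essRange {Z : Type*} [TopologicalSpace Z] (μ : Measure X) (g : X → Z) : Set Z :=
  {z | MapClusterPt z (ae μ) g}

lemma mem_essRange_iff {Z : Type*} [PseudoMetricSpace Z] {g : X → Z} {z : Z} :
    z ∈ essRange μ g ↔ ∀ ε > 0, ∃ᵐ x ∂μ, dist (g x) z < ε :=
  Metric.nhds_basis_ball.mapClusterPt_iff_frequently

lemma ofReal_image_essran (a b : ℝ) (f : ℝ → ℝ) :
    Complex.ofReal '' Essran (Icc a b) f = essRange (leb a b) fun x => (f x : ℂ) := by
  have h_real : Essran (Icc a b) f = essRange (leb a b) f := by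
    ext l
    rw [mem_essRange_iff]
    refine forall₂_congr fun ε _ => ?_
    rw [frequently_ae_iff, Measure.restrict_apply' measurableSet_Icc, pos_iff_ne_zero]
    have h_set : {ξ | ξ ∈ Icc a b ∧ l - ε < f ξ ∧ f ξ < l + ε} =
        {ξ | dist (f ξ) l < ε} ∩ Icc a b := by
      ext ξ
      simp only [mem_ofPred_eq, mem_inter_iff, Real.dist_eq, abs_sub_lt_iff]
      constructor <;> rintro ⟨_, _⟩ <;> grind
    rw [h_set]
  have h_closed : essRange (leb a b) (fun x => (f x : ℂ)) ⊆ range Complex.ofReal := by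
    intro z hz
    refine Complex.isometry_ofReal.isClosedEmbedding.isClosed_range.mem_of_mapClusterPt hz ?_
    exact .of_forall fun x => mem_range_self (f x)
  rw [h_real, ← inter_eq_right.2 h_closed, inter_comm, ← image_preimage_eq_inter_range]
  congr 1
  ext l
  exact (Complex.isometry_ofReal.isUniformInducing.isInducing.mapClusterPt_iff (x := l)).symm

/-- The symbol `g / (1 - τ g)`, `τ = l⁻¹`, of the operator `(1 - τ T)⁻¹ T` when `g` is the symbol
of `T`. -/
noncomputable def resolventSymbol (l : ℂ) (g : X → ℂ) (x : X) : ℂ :=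
  g x / (1 - l⁻¹ * g x)

variable {l : ℂ} {g : X → ℂ}

lemma exists_pos_le_norm_one_sub (hl : l ≠ 0) (hlg : l ∉ essRange μ g) :
    ∃ δ > 0, ∀ᵐ x ∂μ, δ ≤ ‖1 - l⁻¹ * g x‖ := by
  simp only [mem_essRange_iff, not_forall, Filter.not_frequently, not_lt] at hlg
  obtain ⟨ε, hε, h_far⟩ := hlg
  refine ⟨‖l⁻¹‖ * ε, mul_pos (norm_pos_iff.2 (inv_ne_zero hl)) hε, ?_⟩
  filter_upwards [h_far] with x hx
  calc ‖l⁻¹‖ * ε ≤ ‖l⁻¹‖ * dist (g x) l := by gcongr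
    _ = ‖1 - l⁻¹ * g x‖ := by
      rw [dist_comm, dist_eq_norm, ← norm_mul, mul_sub, inv_mul_cancel₀ hl]

lemma memLp_resolventSymbol (hl : l ≠ 0) (hlg : l ∉ essRange μ g) (hg : MemLp g ∞ μ) :
    MemLp (resolventSymbol l g) ∞ μ := by
  obtain ⟨δ, hδ, h_far⟩ := exists_pos_le_norm_one_sub hl hlg
  have h_meas : AEStronglyMeasurable (fun x => (1 - l⁻¹ * g x)⁻¹) μ :=
    (aestronglyMeasurable_const.sub (hg.1.const_mul _)).aemeasurable.inv.aestronglyMeasurable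
  have h_inv : MemLp (fun x => (1 - l⁻¹ * g x)⁻¹) ∞ μ := by
    refine memLp_top_of_bound h_meas δ⁻¹ ?_
    filter_upwards [h_far] with x hx
    rw [norm_inv]
    gcongr
  exact (h_inv.mul hg).ae_eq (.of_forall fun x => (div_eq_mul_inv _ _).symm)

lemma resolventSymbol_ae_eq (hl : l ≠ 0) (hlg : l ∉ essRange μ g) :
    ∀ᵐ x ∂μ, resolventSymbol l g x = g x + l⁻¹ * (g x * resolventSymbol l g x) := by
  obtain ⟨δ, hδ, h_far⟩ := exists_pos_le_norm_one_sub hl hlg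
  filter_upwards [h_far] with x hx
  have hx0 : 1 - l⁻¹ * g x ≠ 0 := norm_pos_iff.1 (hδ.trans_le hx)
  rw [resolventSymbol, div_eq_iff hx0, add_mul, mul_assoc, mul_assoc, div_mul_cancel₀ _ hx0]
  ring

end EssentialRange

section ProductSpace

variable {X Y : Type*} [MeasurableSpace X] [MeasurableSpace Y]
  {μ : Measure X} {ν : Measure Y} [SFinite μ] [SFinite ν]

lemma memLp_tensor (u : Lp ℂ 2 μ) (w : Lp ℂ 2 ν) :
    MemLp (fun z : X × Y => u z.1 * w z.2) 2 (μ.prod ν) := by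
  obtain ⟨h_meas, h_norm⟩ := tensor_norm (Lp.memLp u) (Lp.memLp w).1
  exact ⟨h_meas, h_norm.trans_lt (ENNReal.mul_lt_top (Lp.memLp u).2 (Lp.memLp w).2)⟩

/-- The elementary tensor `(x, y) ↦ u x * w y` in `L²(μ × ν)`. -/
noncomputable def tensorLp (u : Lp ℂ 2 μ) (w : Lp ℂ 2 ν) : Lp ℂ 2 (μ.prod ν) :=
  (memLp_tensor u w).toLp _

lemma coeFn_tensorLp (u : Lp ℂ 2 μ) (w : Lp ℂ 2 ν) :
    tensorLp u w =ᵐ[μ.prod ν] fun z => u z.1 * w z.2 :=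
  (memLp_tensor u w).coeFn_toLp

lemma tensorLp_ne_zero {u : Lp ℂ 2 μ} {w : Lp ℂ 2 ν} (hu : u ≠ 0) (hw : w ≠ 0) :
    tensorLp u w ≠ 0 := by
  have h_norm : ‖tensorLp u w‖ₑ = ‖u‖ₑ * ‖w‖ₑ := by
    rw [tensorLp, Lp.enorm_toLp, (tensor_norm (Lp.memLp u) (Lp.memLp w).1).2, Lp.enorm_def,
      Lp.enorm_def]
  rw [← enorm_ne_zero, h_norm]
  exact mul_ne_zero (enorm_ne_zero.2 hu) (enorm_ne_zero.2 hw)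

lemma ae_ae_slice {F G : X × Y → ℂ} (hFG : F =ᵐ[μ.prod ν] G) :
    ∀ᵐ y ∂ν, ∀ᵐ s ∂μ, F (s, y) = G (s, y) :=
  Measure.ae_ae_of_ae_prod (Measure.measurePreserving_swap.quasiMeasurePreserving.ae hFG)

/-- The inner product of `v` with the slice of `f` at `y`. -/
noncomputable def partialInner (v : Lp ℂ 2 μ) (f : X × Y → ℂ) (y : Y) : ℂ :=
  ∫ s, conj (v s) * f (s, y) ∂μ

lemma partialInner_congr (v : Lp ℂ 2 μ) {f f' : X × Y → ℂ} (h : f =ᵐ[μ.prod ν] f') :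
    partialInner v f =ᵐ[ν] partialInner v f' := by
  filter_upwards [ae_ae_slice h] with y hy
  refine integral_congr_ae ?_
  filter_upwards [hy] with s hs
  rw [hs]

omit [MeasurableSpace Y] [SFinite μ] in
lemma partialInner_sum_tensor {ι : Type*} (t : Finset ι) (v : Lp ℂ 2 μ) (u : ι → Lp ℂ 2 μ)
    (w : ι → Y → ℂ) (y : Y) :
    partialInner v (fun z => ∑ k ∈ t, u k z.1 * w k z.2) y = ∑ k ∈ t, inner ℂ v (u k) * w k y := by
  have h_int : ∀ k ∈ t, Integrable (fun s => conj (v s) * (u k s * w k y)) μ := fun k _ => by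
    simp only [← mul_assoc]
    exact (MemLp.integrable_mul (p := 2) (q := 2) (Lp.memLp v).star (Lp.memLp (u k))).mul_const _
  simp only [partialInner, Finset.mul_sum]
  rw [integral_finsetSum t h_int]
  refine Finset.sum_congr rfl fun k _ => ?_
  simp only [L2.inner_def, RCLike.inner_apply', ← integral_mul_const, mul_assoc]

lemma partialInner_tensorLp (v u : Lp ℂ 2 μ) (w : Lp ℂ 2 ν) :
    partialInner v (tensorLp u w) =ᵐ[ν] fun y => inner ℂ v u * w y := by
  filter_upwards [partialInner_congr v (coeFn_tensorLp u w)] with y hy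
  rw [hy]
  simpa only [Finset.sum_singleton] using
    partialInner_sum_tensor {()} v (fun _ => u) (fun _ => ⇑w) y

end ProductSpace

section DegenerateOperators

variable {X Y : Type*} [MeasurableSpace X] [MeasurableSpace Y]
  {μ : Measure X} {ν : Measure Y} {n m : ℕ}

/-- The partial integral operator in the first variable with kernel
`∑ₖ φₖ(x) conj(φₖ(s)) gₖ(y)`. -/
noncomputable def degPio₁ (ν : Measure Y) (φ : Fin n → Lp ℂ 2 μ) (g : Fin n → Y → ℂ) :
    Lp ℂ 2 (μ.prod ν) →L[ℂ] Lp ℂ 2 (μ.prod ν) :=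
  pio₁ μ ν (kernel₁ (fun k => ⇑(φ k)) g)

/-- The partial integral operator in the second variable with kernel
`∑ⱼ pⱼ(x) ψⱼ(y) conj(ψⱼ(t))`. -/
noncomputable def degPio₂ (μ : Measure X) (ψ : Fin m → Lp ℂ 2 ν) (p : Fin m → X → ℂ) :
    Lp ℂ 2 (μ.prod ν) →L[ℂ] Lp ℂ 2 (μ.prod ν) :=
  pio₂ μ ν (kernel₂ (fun j => ⇑(ψ j)) p)

variable [SFinite μ] [SFinite ν] {φ : Fin n → Lp ℂ 2 μ} {g g' : Fin n → Y → ℂ}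

lemma degPio₁_apply (φ : Fin n → Lp ℂ 2 μ) (hg : ∀ k, MemLp (g k) ∞ ν) (f : Lp ℂ 2 (μ.prod ν)) :
    degPio₁ ν φ g f =ᵐ[μ.prod ν]
      fun z => ∑ k, φ k z.1 * (g k z.2 * partialInner (φ k) f z.2) := by
  obtain ⟨A, hA, h_sum⟩ := exists_pio₁_sum (fun k => Lp.memLp (φ k)) hg
  have h_eq : degPio₁ ν φ g f = ∑ k, A k f := by
    rw [← sum_apply]
    exact Lp.ext ((pio₁_spec (fun k => Lp.memLp (φ k)) hg f).trans (h_sum f).symm)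
  rw [h_eq]
  filter_upwards [Lp.coeFn_fun_finsetSum Finset.univ fun k => A k f, ae_all_iff.2 fun k => hA k f]
    with z hz h_summand
  rw [hz]
  exact Finset.sum_congr rfl fun k _ => h_summand k

lemma degPio₁_congr (φ : Fin n → Lp ℂ 2 μ) (hg : ∀ k, MemLp (g k) ∞ ν) (h : ∀ k, g k =ᵐ[ν] g' k) :
    degPio₁ ν φ g = degPio₁ ν φ g' := by
  ext1 f
  refine Lp.ext ?_
  filter_upwards [degPio₁_apply φ hg f, degPio₁_apply φ (fun k => (hg k).ae_eq (h k)) f,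
    Measure.quasiMeasurePreserving_snd.ae (ae_all_iff.2 h)] with z hz hz' h_eq
  simp only [hz, hz', h_eq]

lemma degPio₁_add_smul (φ : Fin n → Lp ℂ 2 μ) (hg : ∀ k, MemLp (g k) ∞ ν)
    (hg' : ∀ k, MemLp (g' k) ∞ ν) (c : ℂ) :
    degPio₁ ν φ (fun k y => g k y + c * g' k y) = degPio₁ ν φ g + c • degPio₁ ν φ g' := by
  ext1 f
  refine Lp.ext ?_
  filter_upwards [degPio₁_apply φ hg f, degPio₁_apply φ hg' f,
    degPio₁_apply φ (g := fun k y => g k y + c * g' k y)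
      (fun k => (hg k).add ((hg' k).const_mul c)) f,
    Lp.coeFn_add (degPio₁ ν φ g f) (c • degPio₁ ν φ g' f), Lp.coeFn_smul c (degPio₁ ν φ g' f)]
    with z hz hz' h_left h_add h_smul
  rw [add_apply, smul_apply, h_add, Pi.add_apply, h_smul, Pi.smul_apply, h_left, hz, hz',
    Finset.smul_sum, ← Finset.sum_add_distrib]
  refine Finset.sum_congr rfl fun k _ => ?_
  rw [smul_eq_mul]
  ring

lemma partialInner_degPio₁ (hφ : Orthonormal ℂ φ) (hg : ∀ k, MemLp (g k) ∞ ν) (k : Fin n)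
    (f : Lp ℂ 2 (μ.prod ν)) :
    partialInner (φ k) (degPio₁ ν φ g f) =ᵐ[ν] fun y => g k y * partialInner (φ k) f y := by
  filter_upwards [partialInner_congr (φ k) (degPio₁_apply φ hg f)] with y hy
  rw [hy, partialInner_sum_tensor Finset.univ (φ k) φ fun k y => g k y * partialInner (φ k) f y]
  simp only [orthonormal_iff_ite.1 hφ, ite_mul, one_mul, zero_mul, Finset.sum_ite_eq,
    Finset.mem_univ, if_true]

lemma degPio₁_mul_degPio₁ (hφ : Orthonormal ℂ φ) (hg : ∀ k, MemLp (g k) ∞ ν)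
    (hg' : ∀ k, MemLp (g' k) ∞ ν) :
    degPio₁ ν φ g * degPio₁ ν φ g' = degPio₁ ν φ fun k y => g k y * g' k y := by
  ext1 f
  refine Lp.ext ?_
  filter_upwards [degPio₁_apply φ hg (degPio₁ ν φ g' f),
    degPio₁_apply φ (g := fun k y => g k y * g' k y) (fun k => (hg' k).mul (hg k)) f,
    Measure.quasiMeasurePreserving_snd.ae
      (ae_all_iff.2 fun k => partialInner_degPio₁ hφ hg' k f)] with z h_left h_right h_inner
  simp only [mul_apply_eq_comp, h_left, h_right, h_inner, mul_assoc]

lemma degPio₁_tensorLp (φ : Fin n → Lp ℂ 2 μ) (hg : ∀ k, MemLp (g k) ∞ ν)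
    (u : Lp ℂ 2 μ) (w : Lp ℂ 2 ν) :
    degPio₁ ν φ g (tensorLp u w) =ᵐ[μ.prod ν]
      fun z => ∑ k, φ k z.1 * (g k z.2 * (inner ℂ (φ k) u * w z.2)) := by
  filter_upwards [degPio₁_apply φ hg (tensorLp u w), Measure.quasiMeasurePreserving_snd.ae
    (ae_all_iff.2 fun k => partialInner_tensorLp (φ k) u w)] with z hz h_inner
  simp only [hz, h_inner]

lemma degPio₁_tensorLp_eq_zero (hg : ∀ k, MemLp (g k) ∞ ν) {u : Lp ℂ 2 μ}
    (hu : ∀ k, inner ℂ (φ k) u = 0) (w : Lp ℂ 2 ν) : degPio₁ ν φ g (tensorLp u w) = 0 := by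
  refine Lp.ext ?_
  filter_upwards [degPio₁_tensorLp φ hg u w, Lp.coeFn_zero ℂ 2 (μ.prod ν)] with z hz h_zero
  simp only [hz, h_zero, hu, zero_mul, mul_zero, Finset.sum_const_zero, Pi.zero_apply]

lemma degPio₁_tensorLp_self (hφ : Orthonormal ℂ φ) (hg : ∀ k, MemLp (g k) ∞ ν) (i : Fin n)
    (w : Lp ℂ 2 ν) :
    degPio₁ ν φ g (tensorLp (φ i) w) =ᵐ[μ.prod ν] fun z => g i z.2 * tensorLp (φ i) w z := by
  filter_upwards [degPio₁_tensorLp φ hg (φ i) w, coeFn_tensorLp (φ i) w] with z hz h_tensor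
  simp only [hz, h_tensor, orthonormal_iff_ite.1 hφ, ite_mul, one_mul, zero_mul, mul_ite, mul_zero,
    Finset.sum_ite_eq', Finset.mem_univ, if_true]
  ring

section Resolvent

variable {l : ℂ}

lemma degPio₁_resolventSymbol (hφ : Orthonormal ℂ φ) (hg : ∀ k, MemLp (g k) ∞ ν) (hl : l ≠ 0)
    (hlg : ∀ k, l ∉ essRange ν (g k)) :
    degPio₁ ν φ (fun k => resolventSymbol l (g k)) = degPio₁ ν φ g +
      l⁻¹ • (degPio₁ ν φ g * degPio₁ ν φ fun k => resolventSymbol l (g k)) := by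
  have hs : ∀ k, MemLp (resolventSymbol l (g k)) ∞ ν := fun k =>
    memLp_resolventSymbol hl (hlg k) (hg k)
  have h_mul : ∀ k, MemLp (fun y => g k y * resolventSymbol l (g k) y) ∞ ν := fun k =>
    (hs k).mul (hg k)
  rw [degPio₁_mul_degPio₁ hφ hg hs, ← degPio₁_add_smul φ hg h_mul]
  exact degPio₁_congr φ hs fun k => resolventSymbol_ae_eq hl (hlg k)

lemma mem_resolventSet_degPio₁ (hφ : Orthonormal ℂ φ) (hg : ∀ k, MemLp (g k) ∞ ν) (hl : l ≠ 0)
    (hlg : ∀ k, l ∉ essRange ν (g k)) : l ∈ resolventSet ℂ (degPio₁ ν φ g) := by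
  have hs : ∀ k, MemLp (resolventSymbol l (g k)) ∞ ν := fun k =>
    memLp_resolventSymbol hl (hlg k) (hg k)
  have h_comm : Commute (degPio₁ ν φ g) (degPio₁ ν φ fun k => resolventSymbol l (g k)) := by
    rw [commute_iff_eq, degPio₁_mul_degPio₁ hφ hg hs, degPio₁_mul_degPio₁ hφ hs hg]
    simp only [mul_comm]
  exact (isUnit_one_sub_inv_smul_iff hl).1
    (isUnit_one_sub_smul_of_eq_add h_comm (degPio₁_resolventSymbol hφ hg hl hlg))

end Resolvent

end DegenerateOperators

section Swap

variable {X Y : Type*} [MeasurableSpace X] [MeasurableSpace Y]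
  {μ : Measure X} {ν : Measure Y} [SFinite μ] [SFinite ν] {n m : ℕ}
  {φ : Fin n → Lp ℂ 2 μ} {g : Fin n → Y → ℂ} {ψ : Fin m → Lp ℂ 2 ν} {p : Fin m → X → ℂ}

lemma compMeasurePreservingₗᵢ_swap_swap (f : Lp ℂ 2 (μ.prod ν)) :
    Lp.compMeasurePreservingₗᵢ ℂ Prod.swap (Measure.measurePreserving_swap (μ := μ) (ν := ν))
      (Lp.compMeasurePreservingₗᵢ ℂ Prod.swap Measure.measurePreserving_swap f) = f := by
  refine Lp.ext ?_
  have h_swap := Measure.measurePreserving_swap (μ := μ) (ν := ν)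
  have h_swap' := Measure.measurePreserving_swap (μ := ν) (ν := μ)
  filter_upwards [Lp.coeFn_compMeasurePreserving (Lp.compMeasurePreserving _ h_swap' f) h_swap,
    h_swap.quasiMeasurePreserving.ae (Lp.coeFn_compMeasurePreserving f h_swap')] with z hz hz'
  exact hz.trans hz'

/-- The unitary `L²(ν × μ) → L²(μ × ν)` exchanging the two variables. -/
noncomputable def swapLp (μ : Measure X) (ν : Measure Y) [SFinite μ] [SFinite ν] :
    Lp ℂ 2 (ν.prod μ) ≃L[ℂ] Lp ℂ 2 (μ.prod ν) :=
  ContinuousLinearEquiv.equivOfInverse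
    (Lp.compMeasurePreservingₗᵢ ℂ Prod.swap
      Measure.measurePreserving_swap).toContinuousLinearMap
    (Lp.compMeasurePreservingₗᵢ ℂ Prod.swap
      Measure.measurePreserving_swap).toContinuousLinearMap
    compMeasurePreservingₗᵢ_swap_swap compMeasurePreservingₗᵢ_swap_swap

lemma coeFn_swapLp (f : Lp ℂ 2 (ν.prod μ)) : swapLp μ ν f =ᵐ[μ.prod ν] fun z => f z.swap :=
  Lp.coeFn_compMeasurePreserving f Measure.measurePreserving_swap

lemma swapLp_symm : (swapLp μ ν).symm = swapLp ν μ := rfl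

lemma swapLp_tensorLp (u : Lp ℂ 2 μ) (w : Lp ℂ 2 ν) :
    swapLp μ ν (tensorLp w u) = tensorLp u w := by
  refine Lp.ext ?_
  filter_upwards [coeFn_swapLp (tensorLp w u), coeFn_tensorLp u w,
    Measure.measurePreserving_swap.quasiMeasurePreserving.ae (coeFn_tensorLp w u)]
    with z h_swap h_tensor h_tensor'
  rw [h_swap, h_tensor', h_tensor, mul_comm, Prod.fst_swap, Prod.snd_swap]

omit [MeasurableSpace X] [MeasurableSpace Y] in
lemma kernel₁_eq_kernel₂ (ψ : Fin m → Y → ℂ) (p : Fin m → X → ℂ) (x : X) (t y : Y) :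
    kernel₁ ψ p y t x = kernel₂ ψ p x t y :=
  Finset.sum_congr rfl fun j _ => by ring

lemma swapLp_degPio₁ (hp : ∀ j, MemLp (p j) ∞ μ) (f : Lp ℂ 2 (ν.prod μ)) :
    swapLp μ ν (degPio₁ μ ψ p f) = degPio₂ μ ψ p (swapLp μ ν f) := by
  refine Lp.ext ?_
  filter_upwards [coeFn_swapLp (degPio₁ μ ψ p f),
    Measure.measurePreserving_swap.quasiMeasurePreserving.ae
      (pio₁_spec (fun j => Lp.memLp (ψ j)) hp f),
    pio₂_spec (fun j => Lp.memLp (ψ j)) hp (swapLp μ ν f),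
    Measure.quasiMeasurePreserving_fst.ae (Measure.ae_ae_of_ae_prod (coeFn_swapLp f))]
    with z h_swap h_left h_right h_slice
  refine h_swap.trans (h_left.trans (Eq.trans ?_ h_right.symm))
  refine integral_congr_ae ?_
  filter_upwards [h_slice] with t ht
  rw [ht, Prod.fst_swap, Prod.snd_swap, kernel₁_eq_kernel₂, Prod.swap_prod_mk]

lemma conj_degPio₁ (hp : ∀ j, MemLp (p j) ∞ μ) :
    (swapLp μ ν).conjContinuousAlgEquiv (degPio₁ μ ψ p) = degPio₂ μ ψ p := by
  ext1 f
  rw [ContinuousLinearEquiv.conjContinuousAlgEquiv_apply_apply, swapLp_degPio₁ hp,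
    ContinuousLinearEquiv.apply_symm_apply]

lemma conj_degPio₂ (hg : ∀ k, MemLp (g k) ∞ ν) :
    (swapLp μ ν).conjContinuousAlgEquiv (degPio₂ ν φ g) = degPio₁ ν φ g := by
  rw [← conj_degPio₁ hg, ← swapLp_symm, ← ContinuousLinearEquiv.symm_conjContinuousAlgEquiv]
  exact (swapLp μ ν).conjContinuousAlgEquiv.apply_symm_apply _

lemma spectrum_degPio₁_add_degPio₂_swap (hg : ∀ k, MemLp (g k) ∞ ν)
    (hp : ∀ j, MemLp (p j) ∞ μ) :
    spectrum ℂ (degPio₁ μ ψ p + degPio₂ ν φ g) = spectrum ℂ (degPio₁ ν φ g + degPio₂ μ ψ p) := by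
  rw [← AlgEquiv.spectrum_eq (swapLp μ ν).conjContinuousAlgEquiv, map_add, conj_degPio₁ hp,
    conj_degPio₂ hg, add_comm]

lemma mem_resolventSet_degPio₂ (hψ : Orthonormal ℂ ψ) (hp : ∀ j, MemLp (p j) ∞ μ) {l : ℂ}
    (hl : l ≠ 0) (hlp : ∀ j, l ∉ essRange μ (p j)) : l ∈ resolventSet ℂ (degPio₂ μ ψ p) := by
  have h_spectrum : spectrum ℂ (degPio₂ μ ψ p) = spectrum ℂ (degPio₁ μ ψ p) := by
    rw [← conj_degPio₁ hp, AlgEquiv.spectrum_eq]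
  rw [compl_inj_iff.1 h_spectrum]
  exact mem_resolventSet_degPio₁ hψ hp hl hlp

lemma degPio₂_tensorLp_eq_zero (hp : ∀ j, MemLp (p j) ∞ μ) (u : Lp ℂ 2 μ) {w : Lp ℂ 2 ν}
    (hw : ∀ j, inner ℂ (ψ j) w = 0) : degPio₂ μ ψ p (tensorLp u w) = 0 := by
  rw [← swapLp_tensorLp, ← swapLp_degPio₁ hp, degPio₁_tensorLp_eq_zero hp hw, map_zero]

end Swap

section Orthogonal

variable {X : Type*} [MeasurableSpace X] {μ : Measure X}

lemma exists_measurable_injective_unitInterval [MeasurableSpace.CountablySeparated X] :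
    ∃ θ : X → unitInterval, Measurable θ ∧ Function.Injective θ := by
  obtain ⟨f, hf_meas, hf_inj⟩ :=
    MeasurableSpace.measurable_injection_nat_bool_of_countablySeparated X
  have h_emb := measurableEmbedding_sigmoid_comp_embeddingReal (ℕ → Bool)
  exact ⟨_, h_emb.measurable.comp hf_meas, h_emb.injective.comp hf_inj⟩

lemma exists_measurable_subset_lt_top [SigmaFinite μ] {A : Set X} (hA : NullMeasurableSet A μ)
    (hA0 : μ A ≠ 0) : ∃ B ⊆ A, MeasurableSet B ∧ μ B ≠ 0 ∧ μ B < ∞ := by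
  obtain ⟨A', hA'_sub, hA'_meas, hA'_eq⟩ := hA.exists_measurable_subset_ae_eq
  have hA'_pos : 0 < μ A' := by rwa [measure_congr hA'_eq, pos_iff_ne_zero]
  obtain ⟨B, hB_meas, hB_sub, hB_pos, hB_fin⟩ :=
    Measure.exists_subset_measure_lt_top hA'_meas hA'_pos
  exact ⟨B, hB_sub.trans hA'_sub, hB_meas, hB_pos.ne', hB_fin⟩

section PolynomialMultiples

variable {θ : X → unitInterval} {B : Set X}

lemma memLp_indicator_eval (hθ : Measurable θ) (hB : MeasurableSet B) (hB_fin : μ B < ∞)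
    (q : Polynomial ℂ) : MemLp (B.indicator fun x => q.eval (θ x : ℂ)) 2 μ := by
  have h_cont : Continuous fun t : unitInterval => q.eval ((t : ℝ) : ℂ) := by fun_prop
  obtain ⟨C, hC⟩ := isCompact_univ.exists_bound_of_continuousOn h_cont.continuousOn
  rw [memLp_indicator_iff_restrict hB]
  have : IsFiniteMeasure (μ.restrict B) := isFiniteMeasure_restrict.2 hB_fin.ne
  exact .of_bound (h_cont.measurable.comp hθ).aestronglyMeasurable C
    (.of_forall fun x => hC (θ x) (mem_univ _))

/-- The linear map `q ↦ 1_B · (q ∘ θ)` from polynomials to `L²(μ)`. For an atomless `μ` and an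
injective `θ` it is injective, so the functions supported on `B` form an infinite-dimensional
space. -/
noncomputable def polynomialLp (hθ : Measurable θ) (hB : MeasurableSet B) (hB_fin : μ B < ∞) :
    Polynomial ℂ →ₗ[ℂ] Lp ℂ 2 μ where
  toFun q := (memLp_indicator_eval hθ hB hB_fin q).toLp _
  map_add' q r := by
    rw [← MemLp.toLp_add]
    refine MemLp.toLp_congr _ _ (.of_forall fun x => ?_)
    by_cases hx : x ∈ B <;> simp [hx]
  map_smul' c q := by
    rw [RingHom.id_apply, ← MemLp.toLp_const_smul]
    refine MemLp.toLp_congr _ _ (.of_forall fun x => ?_)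
    by_cases hx : x ∈ B <;> simp [hx]

lemma coeFn_polynomialLp (hθ : Measurable θ) (hB : MeasurableSet B) (hB_fin : μ B < ∞)
    (q : Polynomial ℂ) :
    polynomialLp hθ hB hB_fin q =ᵐ[μ] B.indicator fun x => q.eval (θ x : ℂ) :=
  (memLp_indicator_eval hθ hB hB_fin q).coeFn_toLp

lemma polynomialLp_ne_zero [NullSingletonClass μ] (hθ : Measurable θ)
    (hθ_inj : Function.Injective θ) (hB : MeasurableSet B) (hB0 : μ B ≠ 0) (hB_fin : μ B < ∞)
    {q : Polynomial ℂ} (hq : q ≠ 0) :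
    polynomialLp hθ hB hB_fin q ≠ 0 := by
  intro h_zero
  have h_roots : ({x | q.eval (θ x : ℂ) = 0} : Set X).Finite :=
    Finite.preimage (f := fun x => ((θ x : ℝ) : ℂ))
      (Complex.ofReal_injective.comp (Subtype.val_injective.comp hθ_inj)).injOn
      (Polynomial.finite_setOfPred_isRoot hq)
  refine hB0 (measure_eq_zero_iff_ae_notMem.2 ?_)
  filter_upwards [coeFn_polynomialLp hθ hB hB_fin q, Lp.coeFn_zero ℂ 2 μ,
    measure_eq_zero_iff_ae_notMem.1 (h_roots.measure_zero μ)] with x hx hx_zero hx_root hxB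
  rw [h_zero, hx_zero, indicator_of_mem hxB] at hx
  exact hx_root hx.symm

end PolynomialMultiples

lemma exists_ne_zero_orthogonal_supportedOn [MeasurableSpace.CountablySeparated X]
    [SigmaFinite μ] [NullSingletonClass μ] {m : ℕ} (ψ : Fin m → Lp ℂ 2 μ) {A : Set X}
    (hA : NullMeasurableSet A μ) (hA0 : μ A ≠ 0) :
    ∃ w : Lp ℂ 2 μ, w ≠ 0 ∧ (∀ j, inner ℂ (ψ j) w = 0) ∧ ∀ᵐ x ∂μ, x ∉ A → w x = 0 := by
  obtain ⟨θ, hθ, hθ_inj⟩ := exists_measurable_injective_unitInterval (X := X)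
  obtain ⟨B, hBA, hB, hB0, hB_fin⟩ := exists_measurable_subset_lt_top hA hA0
  let L : Polynomial ℂ →ₗ[ℂ] Fin m → ℂ :=
    LinearMap.pi fun j => (innerₛₗ ℂ (ψ j)).comp (polynomialLp hθ hB hB_fin)
  have hL : ¬ Function.Injective L := fun h =>
    Polynomial.not_finite (Module.Finite.of_injective L h)
  rw [injective_iff_map_eq_zero] at hL
  push Not at hL
  obtain ⟨q, hLq, hq⟩ := hL
  refine ⟨polynomialLp hθ hB hB_fin q, polynomialLp_ne_zero hθ hθ_inj hB hB0 hB_fin hq,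
    fun j => congrFun hLq j, ?_⟩
  filter_upwards [coeFn_polynomialLp hθ hB hB_fin q] with x hx hxA
  rw [hx, indicator_of_notMem fun hxB => hxA (hBA hxB)]

end Orthogonal

section Spectrum

variable {X Y : Type*} [MeasurableSpace X] [MeasurableSpace Y]
  {μ : Measure X} {ν : Measure Y} [SigmaFinite μ] [SigmaFinite ν] {n m : ℕ}
  {φ : Fin n → Lp ℂ 2 μ} {g : Fin n → Y → ℂ} {ψ : Fin m → Lp ℂ 2 ν} {p : Fin m → X → ℂ}

lemma essRange₁_subset_spectrum [MeasurableSpace.CountablySeparated Y] [NullSingletonClass ν]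
    (hφ : Orthonormal ℂ φ) (hg : ∀ k, MemLp (g k) ∞ ν) (hp : ∀ j, MemLp (p j) ∞ μ) (i : Fin n) :
    essRange ν (g i) ⊆ spectrum ℂ (degPio₁ ν φ g + degPio₂ μ ψ p) := by
  intro l hl
  refine mem_spectrum_of_approx fun ε hε => ?_
  have hA0 : ν {y | dist (g i y) l < ε} ≠ 0 :=
    frequently_ae_iff.1 (mem_essRange_iff.1 hl ε hε)
  have hA : NullMeasurableSet {y | dist (g i y) l < ε} ν :=
    nullMeasurableSet_lt ((hg i).1.dist aestronglyMeasurable_const).aemeasurable aemeasurable_const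
  obtain ⟨w, hw, hwψ, h_supp⟩ := exists_ne_zero_orthogonal_supportedOn ψ hA hA0
  refine ⟨tensorLp (φ i) w, tensorLp_ne_zero (hφ.ne_zero i) hw, ?_⟩
  rw [add_apply, degPio₂_tensorLp_eq_zero hp _ hwψ, add_zero]
  refine Lp.norm_le_mul_norm_of_ae_le_mul ?_
  filter_upwards [Lp.coeFn_sub (degPio₁ ν φ g (tensorLp (φ i) w)) (l • tensorLp (φ i) w),
    Lp.coeFn_smul l (tensorLp (φ i) w), degPio₁_tensorLp_self hφ hg i w, coeFn_tensorLp (φ i) w,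
    Measure.quasiMeasurePreserving_snd.ae h_supp] with z h_sub h_smul h_self h_tensor hz
  rw [h_sub, Pi.sub_apply, h_smul, Pi.smul_apply, h_self, smul_eq_mul, ← sub_mul, norm_mul]
  by_cases hzA : dist (g i z.2) l < ε
  · rw [← dist_eq_norm]
    gcongr
  · rw [h_tensor, hz hzA, mul_zero, norm_zero, mul_zero, mul_zero]

variable [MeasurableSpace.CountablySeparated X] [NullSingletonClass μ]

lemma essRange₂_subset_spectrum (hψ : Orthonormal ℂ ψ) (hg : ∀ k, MemLp (g k) ∞ ν)
    (hp : ∀ j, MemLp (p j) ∞ μ) (j : Fin m) :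
    essRange μ (p j) ⊆ spectrum ℂ (degPio₁ ν φ g + degPio₂ μ ψ p) := by
  rw [← spectrum_degPio₁_add_degPio₂_swap hg hp]
  exact essRange₁_subset_spectrum hψ hp hg j

lemma zero_mem_spectrum_degPio₁_add_degPio₂ [MeasurableSpace.CountablySeparated Y]
    [NullSingletonClass ν] [NeZero μ] [NeZero ν]
    (hg : ∀ k, MemLp (g k) ∞ ν) (hp : ∀ j, MemLp (p j) ∞ μ) :
    0 ∈ spectrum ℂ (degPio₁ ν φ g + degPio₂ μ ψ p) := by
  obtain ⟨u, hu, huφ, -⟩ := exists_ne_zero_orthogonal_supportedOn φ .univ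
    (Measure.measure_univ_ne_zero.2 (NeZero.ne μ))
  obtain ⟨w, hw, hwψ, -⟩ := exists_ne_zero_orthogonal_supportedOn ψ .univ
    (Measure.measure_univ_ne_zero.2 (NeZero.ne ν))
  refine mem_spectrum_of_approx fun ε hε => ⟨tensorLp u w, tensorLp_ne_zero hu hw, ?_⟩
  rw [add_apply, degPio₁_tensorLp_eq_zero hg huφ, degPio₂_tensorLp_eq_zero hp u hwψ, add_zero,
    zero_smul, sub_zero, norm_zero]
  positivity

end Spectrum

section Determinant

variable {X Y : Type*} [MeasurableSpace X] [MeasurableSpace Y]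
  {μ : Measure X} {ν : Measure Y} [SFinite μ] [SFinite ν] {n m : ℕ}
  {φ : Fin n → Lp ℂ 2 μ} {g : Fin n → Y → ℂ} {ψ : Fin m → Lp ℂ 2 ν} {p : Fin m → X → ℂ}

/-- The set `𝒟₀(T)` for arbitrary measures and complex symbols, in the spectral variable
`l = 1 / τ`. -/
def detSpectrum (φ : Fin n → Lp ℂ 2 μ) (g : Fin n → Y → ℂ) (ψ : Fin m → Lp ℂ 2 ν)
    (p : Fin m → X → ℂ) : Set ℂ :=
  {l | l ≠ 0 ∧ l ∈ resolventSet ℂ (degPio₁ ν φ g) ∩ resolventSet ℂ (degPio₂ μ ψ p) ∧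
    fredholmDet (l⁻¹ ^ 2 • (Ring.inverse (1 - l⁻¹ • degPio₂ μ ψ p) *
      degPio₁ ν φ (fun k => resolventSymbol l (g k)) * degPio₂ μ ψ p)).toLinearMap = 0}

lemma mem_spectrum_iff_mem_detSpectrum (hφ : Orthonormal ℂ φ) (hg : ∀ k, MemLp (g k) ∞ ν)
    (hψ : Orthonormal ℂ ψ) (hp : ∀ j, MemLp (p j) ∞ μ) {l : ℂ} (hl : l ≠ 0)
    (hlg : ∀ k, l ∉ essRange ν (g k)) (hlp : ∀ j, l ∉ essRange μ (p j)) :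
    l ∈ spectrum ℂ (degPio₁ ν φ g + degPio₂ μ ψ p) ↔ l ∈ detSpectrum φ g ψ p := by
  have hl₁ : l ∈ resolventSet ℂ (degPio₁ ν φ g) := mem_resolventSet_degPio₁ hφ hg hl hlg
  have hl₂ : l ∈ resolventSet ℂ (degPio₂ μ ψ p) := mem_resolventSet_degPio₂ hψ hp hl hlp
  have h_resolvent := one_sub_smul_mul_eq_of_eq_add (degPio₁_resolventSymbol hφ hg hl hlg)
  have h_finite : FiniteDimensional ℂ (LinearMap.range
      (degPio₁ ν φ (fun k => resolventSymbol l (g k)) * degPio₂ μ ψ p).toLinearMap) :=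
    finiteDimensional_range_pio₁_comp_pio₂ (fun k => Lp.memLp (φ k))
      (fun k => memLp_resolventSymbol hl (hlg k) (hg k)) (fun j => Lp.memLp (ψ j)) hp
  rw [mem_spectrum_add_iff hl hl₁ hl₂ h_resolvent]
  exact ⟨fun h_det => ⟨hl, ⟨hl₁, hl₂⟩, h_det⟩, fun h => h.2.2⟩

lemma setD₀_eq_detSpectrum {a b c d : ℝ} (φ : Fin n → Lp ℂ 2 (leb a b)) (h : Fin n → ℝ → ℝ)
    (ψ : Fin m → Lp ℂ 2 (leb c d)) (p : Fin m → ℝ → ℝ) :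
    setD₀ φ h ψ p = detSpectrum φ (fun k y => (h k y : ℂ)) ψ fun j x => (p j x : ℂ) := by
  have h_mem : ∀ l : ℂ, l⁻¹ ∈ setD φ h ψ p ↔
      l ∈ detSpectrum φ (fun k y => (h k y : ℂ)) ψ fun j x => (p j x : ℂ) := fun l => by
    refine and_congr inv_eq_zero.not (and_congr ?_ Iff.rfl)
    rw [inv_inv]
    rfl
  ext l
  rw [← h_mem]
  constructor
  · rintro ⟨τ, hτ, rfl⟩
    rwa [one_div, inv_inv]
  · intro hl
    exact ⟨l⁻¹, hl, by rw [one_div, inv_inv]⟩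

lemma neZero_leb {a b : ℝ} (hab : a < b) : NeZero (leb a b) :=
  ⟨by rw [Ne, Measure.restrict_eq_zero, Real.volume_Icc, ENNReal.ofReal_eq_zero]; linarith⟩

end Determinant

end PartialIntegral

theorem theorem4p6_general {X Y : Type*} [MeasurableSpace X] [MeasurableSpace Y]
    [MeasurableSpace.CountablySeparated X] [MeasurableSpace.CountablySeparated Y]
    {μ : Measure X} {ν : Measure Y} [SigmaFinite μ] [SigmaFinite ν]
    [NullSingletonClass μ] [NullSingletonClass ν] [NeZero μ] [NeZero ν] {n m : ℕ}
    (φ : Fin n → Lp ℂ 2 μ) (hφ : Orthonormal ℂ φ)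
    (g : Fin n → Y → ℂ) (hg : ∀ k, MemLp (g k) ∞ ν)
    (ψ : Fin m → Lp ℂ 2 ν) (hψ : Orthonormal ℂ ψ)
    (p : Fin m → X → ℂ) (hp : ∀ j, MemLp (p j) ∞ μ) :
    spectrum ℂ (PartialIntegral.degPio₁ ν φ g + PartialIntegral.degPio₂ μ ψ p) =
      {0} ∪ (⋃ k, PartialIntegral.essRange ν (g k)) ∪ (⋃ j, PartialIntegral.essRange μ (p j))
        ∪ PartialIntegral.detSpectrum φ g ψ p := by
  ext l
  simp only [mem_union, mem_singleton_iff, mem_iUnion]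
  by_cases hl : l = 0
  · exact iff_of_true (hl ▸ PartialIntegral.zero_mem_spectrum_degPio₁_add_degPio₂ hg hp)
      (.inl (.inl (.inl hl)))
  by_cases hlg : ∃ k, l ∈ PartialIntegral.essRange ν (g k)
  · obtain ⟨k, hk⟩ := hlg
    exact iff_of_true (PartialIntegral.essRange₁_subset_spectrum hφ hg hp k hk)
      (.inl (.inl (.inr ⟨k, hk⟩)))
  by_cases hlp : ∃ j, l ∈ PartialIntegral.essRange μ (p j)
  · obtain ⟨j, hj⟩ := hlp
    exact iff_of_true (PartialIntegral.essRange₂_subset_spectrum hψ hg hp j hj)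
      (.inl (.inr ⟨j, hj⟩))
  rw [PartialIntegral.mem_spectrum_iff_mem_detSpectrum hφ hg hψ hp hl (not_exists.1 hlg)
    (not_exists.1 hlp)]
  simp only [hl, hlg, hlp, false_or]

theorem theorem4p6 {a b c d : ℝ} (hab : a < b) (hcd : c < d) {n m : ℕ}
    (φ : Fin n → Lp ℂ 2 (PartialIntegral.leb a b)) (hφ : Orthonormal ℂ φ)
    (h : Fin n → ℝ → ℝ) (hh : ∀ i, MemLp (h i) ∞ (PartialIntegral.leb c d))
    (ψ : Fin m → Lp ℂ 2 (PartialIntegral.leb c d)) (hψ : Orthonormal ℂ ψ)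
    (p : Fin m → ℝ → ℝ) (hp : ∀ j, MemLp (p j) ∞ (PartialIntegral.leb a b)) :
    spectrum ℂ (PartialIntegral.T₁ φ h c d + PartialIntegral.T₂ ψ p a b) =
      {0} ∪ (⋃ i, Complex.ofReal '' PartialIntegral.Essran (Icc c d) (h i))
        ∪ (⋃ j, Complex.ofReal '' PartialIntegral.Essran (Icc a b) (p j))
        ∪ PartialIntegral.setD₀ φ h ψ p := by
  have := PartialIntegral.neZero_leb hab
  have := PartialIntegral.neZero_leb hcd
  simp only [PartialIntegral.ofReal_image_essran, PartialIntegral.setD₀_eq_detSpectrum]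
  exact theorem4p6_general φ hφ _ (fun k => (hh k).ofReal) ψ hψ _ fun j => (hp j).ofReal
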